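/- Let $d\in\mathbb{N}$ and let $C\subset\mathbb{R}^d$ be a convex polytope, i.e. the convex hull of finitely many points, that is not contained in a line (so $C$ has dimension at least $2$, and $d\ge 2$). Call $C$ *1-dimensional fractal-decomposable with a set* $K\subset\mathbb{R}^d$ if $\operatorname{conv}(K)=C$ and $\pi_W(K)=\pi_W(C)$ for every one-dimensional linear subspace $W$ of $\mathbb{R}^d$, where $\pi_W$ is the orthogonal projection onto $W$. A *self-affine set* is a non-empty compact set $F\subset\mathbb{R}^d$ with $F=\bigcup_{i=1}^N\phi_i(F)$ for finitely many maps $\phi_i(x)=T_ix+t_i$, where $t_i\in\mathbb{R}^d$ and $T_i$ is an invertible $d\times d$ matrix of (Euclidean) operator norm $\|T_i\|<1$. A *rectifiable $1$-set* is a set $E\subset\mathbb{R}^d$ with $0<\mathcal{H}^1(E)<\infty$ for which there are countably many sets $A_i\subset\mathbb{R}$ and Lipschitz functions $f_i:A_i\to\mathbb{R}^d$ with $\mathcal{H}^1\bigl(E\setminus\bigcup_i f_i(A_i)\bigr)=0$; here $\mathcal{H}^1$ is one-dimensional Hausdorff measure. Then: (1) For every $\varepsilon>0$ there is a totally disconnected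 compact set $K$ that is a finite union of self-affine sets, has Hausdorff dimension $1\le\dim_H K\le 1+\varepsilon$, and is such that $C$ is 1-dimensional fractal-decomposable with $K$. (2) There is a totally disconnected compact rectifiable $1$-set $K$ such that $C$ is 1-dimensional fractal-decomposable with $K$. -/

import Mathlib

open MeasureTheory Set
open scoped NNReal ENNReal

/-- A convex polytope: the convex hull of finitely many points. -/
def IsConvexPolytope {d : ℕ} (C : Set (EuclideanSpace ℝ (Fin d))) : Prop :=
  ∃ V : Finset (EuclideanSpace ℝ (Fin d)), C = convexHull ℝ (V : Set (EuclideanSpace ℝ (Fin d)))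

/-- `C` is `k`-dimensional fractal-decomposable with the set `K`: the convex hull of `K` is `C`, and
`K` and `C` have the same orthogonal projection on every `k`-dimensional linear subspace. -/
def FractalDecomposable {d : ℕ} (k : ℕ) (C K : Set (EuclideanSpace ℝ (Fin d))) : Prop :=
  convexHull ℝ K = C ∧
    ∀ W : Submodule ℝ (EuclideanSpace ℝ (Fin d)), Module.finrank ℝ W = k →
      W.starProjection '' K = W.starProjection '' C

/-- A self-affine set: the non-empty compact attractor `K = ⋃ i, φ i '' K` of a finite family of
maps `φ i x = T i x + t i`, with `T i` linear, invertible and of operator norm less than one. -/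
def IsSelfAffineSet {d : ℕ} (K : Set (EuclideanSpace ℝ (Fin d))) : Prop :=
  ∃ (N : ℕ) (T : Fin N → (EuclideanSpace ℝ (Fin d) ≃L[ℝ] EuclideanSpace ℝ (Fin d)))
    (t : Fin N → EuclideanSpace ℝ (Fin d)),
    (∀ i, ‖(T i : EuclideanSpace ℝ (Fin d) →L[ℝ] EuclideanSpace ℝ (Fin d))‖ < 1) ∧
      K.Nonempty ∧ IsCompact K ∧ K = ⋃ i, (fun x => T i x + t i) '' K

/-- A finite union of self-affine sets. -/
def IsFiniteUnionOfSelfAffineSets {d : ℕ} (K : Set (EuclideanSpace ℝ (Fin d))) : Prop :=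
  ∃ (n : ℕ) (F : Fin n → Set (EuclideanSpace ℝ (Fin d))),
    (∀ j, IsSelfAffineSet (F j)) ∧ K = ⋃ j, F j

/-- A `1`-set: a set of positive and finite one-dimensional Hausdorff measure. -/
def IsOneSet {d : ℕ} (E : Set (EuclideanSpace ℝ (Fin d))) : Prop :=
  0 < (Measure.hausdorffMeasure 1 : Measure (EuclideanSpace ℝ (Fin d))) E ∧
    (Measure.hausdorffMeasure 1 : Measure (EuclideanSpace ℝ (Fin d))) E < ∞

/-- A rectifiable `1`-set: a `1`-set that is covered, up to a set of one-dimensional Hausdorff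
measure zero, by countably many Lipschitz images `f i '' A i` of subsets `A i` of the real line. -/
def IsRectifiableOneSet {d : ℕ} (E : Set (EuclideanSpace ℝ (Fin d))) : Prop :=
  IsOneSet E ∧
    ∃ (A : ℕ → Set ℝ) (f : ℕ → ℝ → EuclideanSpace ℝ (Fin d)) (L : ℕ → ℝ≥0),
      (∀ i, LipschitzOnWith (L i) (f i) (A i)) ∧
        (Measure.hausdorffMeasure 1 : Measure (EuclideanSpace ℝ (Fin d)))
          (E \ ⋃ i, f i '' A i) = 0

/-! The heart of the proof is a planar attractor `jumpGraph` running from (0,0) to (1,0). It is a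
graph over [0,1] whose jumps, at the dyadic rationals, are all downward. For s ≥ 0 the function x +
s·y goes from 0 to 1 along it and can only jump down, so it skips no value in [0,1]
(`exists_mem_jumpGraph`). The jumps disconnect the set completely, because the two branch images are
disjoint. The shear (x, y) ↦ (x, 2x - y) turns the graph into a monotone one, so the set is a
Lipschitz image of a bounded subset of ℝ.

For a polytope with finite generating set V, put an affine copy of `jumpGraph` from u to v inside
every nondegenerate triangle u, v, p with vertices in V. If a linear functional f attains its
minimum over V at u and its maximum at v, with f u < f v, then on such a copy f is, up to an
increasing affine change, x + s·y with s ≥ 0. The copy therefore realises every value of f on the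
polytope; non-collinearity supplies p. The finite union of copies has positive finite length, hence
dimension exactly 1, and each copy is self-affine, so one set proves both claims. -/

/-- The left branch of the planar iterated function system. -/
noncomputable def leftBranch (z : ℝ × ℝ) : ℝ × ℝ := (z.1 / 2, z.2 / 4 + z.1 / 2)

/-- The right branch of the planar iterated function system. -/
noncomputable def rightBranch (z : ℝ × ℝ) : ℝ × ℝ := ((z.1 + 1) / 2, z.2 / 4)

/-- The Hutchinson operator of the two branches. -/
def branchStep (S : Set (ℝ × ℝ)) : Set (ℝ × ℝ) := leftBranch '' S ∪ rightBranch '' S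

/-- A triangle that both branches map into itself. -/
def baseTriangle : Set (ℝ × ℝ) := {z | 0 ≤ z.2 ∧ z.2 ≤ 2 * z.1 ∧ z.1 + z.2 ≤ 1}

/-- The `n`-th approximation of the attractor. -/
def branchStage : ℕ → Set (ℝ × ℝ)
  | 0 => baseTriangle
  | n + 1 => branchStep (branchStage n)

/-- The attractor of the two branches. It is the closure of the graph of a function on the unit
interval that is continuous up to downward jumps at the dyadic rationals. -/
def jumpGraph : Set (ℝ × ℝ) := ⋂ n, branchStage n

/-! ### Compactness and invariance of the planar attractor. -/

lemma continuous_leftBranch : Continuous leftBranch := by unfold leftBranch; fun_prop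

lemma continuous_rightBranch : Continuous rightBranch := by unfold rightBranch; fun_prop

lemma injective_leftBranch : Function.Injective leftBranch := by
  rintro ⟨a, b⟩ ⟨c, d⟩ h
  simp only [leftBranch, Prod.mk.injEq] at h
  ext <;> simp only <;> linarith [h.1, h.2]

lemma injective_rightBranch : Function.Injective rightBranch := by
  rintro ⟨a, b⟩ ⟨c, d⟩ h
  simp only [rightBranch, Prod.mk.injEq] at h
  ext <;> simp only <;> linarith [h.1, h.2]

lemma branchStep_mono {S T : Set (ℝ × ℝ)} (h : S ⊆ T) : branchStep S ⊆ branchStep T :=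
  union_subset_union (image_mono h) (image_mono h)

lemma branchStep_baseTriangle_subset : branchStep baseTriangle ⊆ baseTriangle := by
  rintro _ (⟨⟨x, y⟩, ⟨h1, h2, h3⟩, rfl⟩ | ⟨⟨x, y⟩, ⟨h1, h2, h3⟩, rfl⟩) <;>
  simp only [leftBranch, rightBranch, baseTriangle, mem_ofPred_eq] at * <;>
  refine ⟨?_, ?_, ?_⟩ <;> linarith

lemma isCompact_baseTriangle : IsCompact baseTriangle := by
  refine (isCompact_Icc (a := ((0 : ℝ), (0 : ℝ))) (b := (1, 1))).of_isClosed_subset ?_ ?_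
  · have h1 : IsClosed {z : ℝ × ℝ | 0 ≤ z.2} := isClosed_le (by fun_prop) (by fun_prop)
    have h2 : IsClosed {z : ℝ × ℝ | z.2 ≤ 2 * z.1} := isClosed_le (by fun_prop) (by fun_prop)
    have h3 : IsClosed {z : ℝ × ℝ | z.1 + z.2 ≤ 1} := isClosed_le (by fun_prop) (by fun_prop)
    exact h1.inter (h2.inter h3)
  · rintro ⟨x, y⟩ ⟨h1, h2, h3⟩
    simp only at h1 h2 h3
    simp only [mem_Icc, Prod.mk_le_mk]
    refine ⟨⟨?_, ?_⟩, ?_, ?_⟩ <;> linarith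

lemma branchStage_succ_subset (n : ℕ) : branchStage (n + 1) ⊆ branchStage n := by
  induction n with
  | zero => exact branchStep_baseTriangle_subset
  | succ n ih => exact branchStep_mono ih

lemma isCompact_branchStage (n : ℕ) : IsCompact (branchStage n) := by
  induction n with
  | zero => exact isCompact_baseTriangle
  | succ n ih =>
    exact (ih.image continuous_leftBranch).union (ih.image continuous_rightBranch)

lemma isCompact_jumpGraph : IsCompact jumpGraph :=
  (isCompact_branchStage 0).of_isClosed_subset
    (isClosed_iInter fun n => (isCompact_branchStage n).isClosed) (iInter_subset _ 0)

lemma jumpGraph_subset_baseTriangle : jumpGraph ⊆ baseTriangle := iInter_subset _ 0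

lemma antitone_branchStage : Antitone branchStage := antitone_nat_of_succ_le branchStage_succ_subset

/-- Since the stages decrease, a point missing from one left image lies in every right image;
injectivity makes its preimages at all stages coincide. -/
lemma jumpGraph_eq : jumpGraph = branchStep jumpGraph := by
  apply Subset.antisymm
  · intro z hz
    have hz' : ∀ n, z ∈ branchStage n := mem_iInter.1 hz
    by_cases h : ∀ n, z ∈ leftBranch '' branchStage n
    · obtain ⟨w, -, hwz⟩ := h 0
      refine Or.inl ⟨w, mem_iInter.2 fun n => ?_, hwz⟩
      obtain ⟨w', hw', h'⟩ := h n
      rwa [← injective_leftBranch (h'.trans hwz.symm)]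
    · push Not at h
      obtain ⟨N, hN⟩ := h
      have hr : ∀ n, z ∈ rightBranch '' branchStage n := by
        intro n
        rcases hz' (max n N + 1) with h' | h'
        · exact (hN (image_mono (antitone_branchStage (le_max_right n N)) h')).elim
        · exact image_mono (antitone_branchStage (le_max_left n N)) h'
      obtain ⟨w, -, hwz⟩ := hr 0
      refine Or.inr ⟨w, mem_iInter.2 fun n => ?_, hwz⟩
      obtain ⟨w', hw', h'⟩ := hr n
      rwa [← injective_rightBranch (h'.trans hwz.symm)]
  · intro z hz
    refine mem_iInter.2 fun n => branchStage_succ_subset n ?_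
    exact branchStep_mono (iInter_subset _ n) hz

lemma zero_mem_jumpGraph : (0 : ℝ × ℝ) ∈ jumpGraph := by
  refine mem_iInter.2 fun n => ?_
  induction n with
  | zero => simp [branchStage, baseTriangle]
  | succ n ih => exact Or.inl ⟨0, ih, by simp [leftBranch]⟩

/-! ### Lines that meet the attractor. -/

/-- Pulling the line x + s·y = c back through a branch gives a line of the same kind: x +
s/(2(1+s))·y = 2c/(1+s) on the left, x + (s/2)·y = 2c - 1 on the right. Choosing the branch by
comparing c with 1/2 keeps the new constant in [0,1]. -/
lemma exists_mem_branchStage (n : ℕ) {s c : ℝ} (hs : 0 ≤ s) (hc : c ∈ Icc (0 : ℝ) 1) :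
    ∃ z ∈ branchStage n, z.1 + s * z.2 = c := by
  induction n generalizing s c with
  | zero =>
    refine ⟨(c, 0), ⟨le_rfl, ?_, ?_⟩, by simp⟩
    · simpa using hc.1
    · simpa using hc.2
  | succ n ih =>
    rcases le_total c (1 / 2) with h | h
    · have h1 : 0 < 1 + s := by linarith
      obtain ⟨z, hz, hzc⟩ := ih (s := s / (2 * (1 + s))) (c := 2 * c / (1 + s)) (by positivity)
        ⟨div_nonneg (by linarith [hc.1]) h1.le, by rw [div_le_one h1]; linarith⟩
      refine ⟨leftBranch z, Or.inl ⟨z, hz, rfl⟩, ?_⟩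
      simp only [leftBranch]
      field_simp at hzc
      linarith
    · obtain ⟨z, hz, hzc⟩ := ih (s := s / 2) (c := 2 * c - 1) (by positivity)
        ⟨by linarith, by linarith [hc.2]⟩
      refine ⟨rightBranch z, Or.inr ⟨z, hz, rfl⟩, ?_⟩
      simp only [rightBranch]
      linarith

lemma exists_mem_jumpGraph {s c : ℝ} (hs : 0 ≤ s) (hc : c ∈ Icc (0 : ℝ) 1) :
    ∃ z ∈ jumpGraph, z.1 + s * z.2 = c := by
  have hcl : IsClosed {z : ℝ × ℝ | z.1 + s * z.2 = c} :=
    isClosed_eq (by fun_prop) (by fun_prop)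
  obtain ⟨z, hz⟩ := IsCompact.nonempty_iInter_of_sequence_nonempty_isCompact_isClosed
    (fun n => branchStage n ∩ {z : ℝ × ℝ | z.1 + s * z.2 = c})
    (fun n => inter_subset_inter_left _ (branchStage_succ_subset n))
    (fun n => by
      obtain ⟨z, hz, h⟩ := exists_mem_branchStage n hs hc
      exact ⟨z, hz, h⟩)
    ((isCompact_branchStage 0).inter_right hcl)
    (fun n => (isCompact_branchStage n).isClosed.inter hcl)
  rw [mem_iInter] at hz
  exact ⟨z, mem_iInter.2 fun n => (hz n).1, (hz 0).2⟩

/-! ### Total disconnectedness of the attractor. -/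

/-- The first coordinates can agree only at x = 1/2, where the triangle forces the preimages (1,0)
and (0,0); their images have heights 1/2 and 0. -/
lemma disjoint_branches : Disjoint (leftBranch '' jumpGraph) (rightBranch '' jumpGraph) := by
  rw [Set.disjoint_left]
  rintro _ ⟨⟨a, b⟩, hp, rfl⟩ ⟨⟨c, d⟩, hq, h⟩
  obtain ⟨p1, p2, p3⟩ := jumpGraph_subset_baseTriangle hp
  obtain ⟨q1, q2, q3⟩ := jumpGraph_subset_baseTriangle hq
  simp only [leftBranch, rightBranch, Prod.mk.injEq] at *
  linarith [h.1, h.2]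

lemma dist_leftBranch_le (z w : ℝ × ℝ) :
    dist (leftBranch z) (leftBranch w) ≤ 3 / 4 * dist z w := by
  simp only [leftBranch, Prod.dist_eq, Real.dist_eq]
  have h1 := le_max_left |z.1 - w.1| |z.2 - w.2|
  have h2 := le_max_right |z.1 - w.1| |z.2 - w.2|
  have h3 := abs_le.1 h1
  have h4 := abs_le.1 h2
  refine max_le (abs_le.2 ⟨?_, ?_⟩) (abs_le.2 ⟨?_, ?_⟩) <;> linarith [abs_nonneg (z.1 - w.1)]

lemma dist_rightBranch_le (z w : ℝ × ℝ) :
    dist (rightBranch z) (rightBranch w) ≤ 3 / 4 * dist z w := by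
  simp only [rightBranch, Prod.dist_eq, Real.dist_eq]
  have h1 := le_max_left |z.1 - w.1| |z.2 - w.2|
  have h2 := le_max_right |z.1 - w.1| |z.2 - w.2|
  have h3 := abs_le.1 h1
  have h4 := abs_le.1 h2
  refine max_le (abs_le.2 ⟨?_, ?_⟩) (abs_le.2 ⟨?_, ?_⟩) <;> linarith [abs_nonneg (z.1 - w.1)]

/-- A preconnected subset of `jumpGraph` is the image under one branch of another such subset. -/
lemma exists_preconnected_preimage {S : Set (ℝ × ℝ)} (hS : IsPreconnected S)
    (hSJ : S ⊆ jumpGraph) :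
    ∃ f ∈ ({leftBranch, rightBranch} : Set (ℝ × ℝ → ℝ × ℝ)), ∃ R ⊆ jumpGraph,
      IsPreconnected R ∧ S = f '' R := by
  have key : ∀ f : ℝ × ℝ → ℝ × ℝ, Continuous f → Function.Injective f → S ⊆ f '' jumpGraph →
      ∃ R ⊆ jumpGraph, IsPreconnected R ∧ S = f '' R := by
    intro f hf hi hsub
    refine ⟨jumpGraph ∩ f ⁻¹' S, inter_subset_left, ?_, ?_⟩
    · have : CompactSpace jumpGraph := isCompact_iff_compactSpace.1 isCompact_jumpGraph
      have hemb : Topology.IsClosedEmbedding (fun z : jumpGraph => f z) :=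
        (hf.comp continuous_subtype_val).isClosedEmbedding
          (hi.comp Subtype.val_injective)
      have h1 : IsPreconnected ((fun z : jumpGraph => f z) '' ((fun z : jumpGraph => f z) ⁻¹' S)) := by
        rw [image_preimage_eq_inter_range, inter_eq_left.2]
        · exact hS
        · rw [← image_eq_range]; exact hsub
      have h2 := (hemb.isInducing.isPreconnected_image.1 h1).image _ continuous_subtype_val.continuousOn
      convert h2 using 1
      ext z
      simp [and_comm]
    · rw [image_inter_preimage]; exact (inter_eq_right.2 hsub).symm
  have hcov : S ⊆ leftBranch '' jumpGraph ∪ rightBranch '' jumpGraph := by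
    intro z hz
    have := hSJ hz
    rw [jumpGraph_eq] at this
    exact this
  have hl := (isCompact_jumpGraph.image continuous_leftBranch).isClosed
  have hr := (isCompact_jumpGraph.image continuous_rightBranch).isClosed
  rcases isPreconnected_iff_subset_of_disjoint_closed.1 hS _ _ hl hr hcov
    (by rw [disjoint_branches.inter_eq, inter_empty]) with h | h
  · exact ⟨_, Or.inl rfl, key _ continuous_leftBranch injective_leftBranch h⟩
  · exact ⟨_, Or.inr rfl, key _ continuous_rightBranch injective_rightBranch h⟩

/-- A preconnected subset can be pulled back through n branches, each contracting by 3/4 in the sup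
metric, so its diameter is at most (3/4)^n times that of the attractor. -/
lemma isTotallyDisconnected_jumpGraph : IsTotallyDisconnected jumpGraph := by
  obtain ⟨D, hD⟩ := Metric.isBounded_iff.1 isCompact_jumpGraph.isBounded
  have key : ∀ n : ℕ, ∀ S ⊆ jumpGraph, IsPreconnected S → ∀ z ∈ S, ∀ w ∈ S,
      dist z w ≤ (3 / 4) ^ n * D := by
    intro n
    induction n with
    | zero => intro S hS _ z hz w hw; simpa using hD (hS hz) (hS hw)
    | succ n ih =>
      intro S hS hc z hz w hw
      obtain ⟨f, hf, R, hR, hRc, rfl⟩ := exists_preconnected_preimage hc hS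
      obtain ⟨z, hz, rfl⟩ := hz
      obtain ⟨w, hw, rfl⟩ := hw
      have h1 := ih R hR hRc z hz w hw
      have h2 : dist (f z) (f w) ≤ 3 / 4 * dist z w := by
        rcases hf with rfl | rfl
        · exact dist_leftBranch_le z w
        · exact dist_rightBranch_le z w
      rw [pow_succ]
      linarith
  intro S hS hc z hz w hw
  have hlim : Filter.Tendsto (fun n : ℕ => (3 / 4 : ℝ) ^ n * D) Filter.atTop (nhds (0 * D)) :=
    (tendsto_pow_atTop_nhds_zero_of_lt_one (by norm_num) (by norm_num)).mul_const D
  rw [zero_mul] at hlim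
  exact dist_le_zero.1 (ge_of_tendsto' hlim fun n => key n S hS hc z hz w hw)

/-! ### Monotonicity after a shear and Lipschitz parametrization. -/

/-- After a shear, both coordinates increase together along `jumpGraph`. -/
lemma jumpGraph_monotone {p q : ℝ × ℝ} (hp : p ∈ jumpGraph) (hq : q ∈ jumpGraph) :
    0 ≤ (p.1 - q.1) * (2 * (p.1 - q.1) - (p.2 - q.2)) := by
  set F : (ℝ × ℝ) × (ℝ × ℝ) → ℝ := fun w =>
    (w.1.1 - w.2.1) * (2 * (w.1.1 - w.2.1) - (w.1.2 - w.2.2)) with hF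
  -- It suffices that the minimum of `F` is nonnegative. If the minimizing pair lies in one branch,
  -- its value is at least 1/8 of the value at the preimages, which is itself no smaller than the
  -- minimum; this excludes a negative minimum. In different branches, both factors have the same
  -- sign.
  obtain ⟨⟨p₀, q₀⟩, hm, hmin⟩ := (isCompact_jumpGraph.prod isCompact_jumpGraph).exists_isMinOn
    ⟨(p, q), hp, hq⟩ (f := F) (by fun_prop)
  have hmin' : ∀ p ∈ jumpGraph, ∀ q ∈ jumpGraph, F (p₀, q₀) ≤ F (p, q) :=
    fun p hp q hq => hmin (show (p, q) ∈ jumpGraph ×ˢ jumpGraph from ⟨hp, hq⟩)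
  refine le_trans ?_ (hmin' p hp q hq)
  obtain ⟨h1, h2⟩ := hm
  have cross : ∀ p ∈ jumpGraph, ∀ q ∈ jumpGraph,
      (leftBranch p).1 - (rightBranch q).1 ≤ 0 ∧
      2 * ((leftBranch p).1 - (rightBranch q).1) - ((leftBranch p).2 - (rightBranch q).2) ≤ 0 := by
    rintro ⟨a, b⟩ hp ⟨c, d⟩ hq
    obtain ⟨p1, p2, p3⟩ := jumpGraph_subset_baseTriangle hp
    obtain ⟨q1, q2, q3⟩ := jumpGraph_subset_baseTriangle hq
    simp only [leftBranch, rightBranch] at *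
    constructor <;> linarith
  rw [jumpGraph_eq] at h1 h2
  rcases h1 with ⟨p, hp, rfl⟩ | ⟨p, hp, rfl⟩ <;> rcases h2 with ⟨q, hq, rfl⟩ | ⟨q, hq, rfl⟩
  · have h := hmin' p hp q hq
    simp only [hF, leftBranch] at h ⊢
    nlinarith [sq_nonneg (p.1 - q.1)]
  · exact mul_nonneg_of_nonpos_of_nonpos (cross p hp q hq).1 (cross p hp q hq).2
  · have h := mul_nonneg_of_nonpos_of_nonpos (cross q hq p hp).1 (cross q hq p hp).2
    simp only [hF]
    linarith
  · have h := hmin' p hp q hq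
    simp only [hF, rightBranch] at h ⊢
    nlinarith [sq_nonneg (p.1 - q.1)]

lemma exists_lipschitz_param_jumpGraph : ∃ (A : Set ℝ) (g : ℝ → ℝ × ℝ),
    Bornology.IsBounded A ∧ LipschitzOnWith 2 g A ∧ g '' A = jumpGraph := by
  -- `τ` is x + (2x - y), a sum of two coordinates that increase together, so a difference of `τ`
  -- dominates the difference of each.
  set τ : ℝ × ℝ → ℝ := fun z => 3 * z.1 - z.2 with hτ
  have hd : ∀ z ∈ jumpGraph, ∀ w ∈ jumpGraph, dist z w ≤ 2 * dist (τ z) (τ w) := by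
    intro z hz w hw
    have h := jumpGraph_monotone hz hw
    simp only [hτ, Prod.dist_eq, Real.dist_eq]
    rw [show 3 * z.1 - z.2 - (3 * w.1 - w.2)
      = (z.1 - w.1) + (2 * (z.1 - w.1) - (z.2 - w.2)) by ring]
    set a := z.1 - w.1
    set b := z.2 - w.2
    rcases mul_nonneg_iff.1 h with ⟨h1, h2⟩ | ⟨h1, h2⟩
    · rw [abs_of_nonneg (add_nonneg h1 h2)]
      refine max_le (abs_le.2 ⟨?_, ?_⟩) (abs_le.2 ⟨?_, ?_⟩) <;> linarith
    · rw [abs_of_nonpos (add_nonpos h1 h2)]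
      refine max_le (abs_le.2 ⟨?_, ?_⟩) (abs_le.2 ⟨?_, ?_⟩) <;> linarith
  have hinj : InjOn τ jumpGraph := by
    intro z hz w hw h
    have := hd z hz w hw
    rw [h, dist_self, mul_zero] at this
    exact dist_le_zero.1 this
  refine ⟨τ '' jumpGraph, Function.invFunOn τ jumpGraph, ?_, ?_, ?_⟩
  · exact (isCompact_jumpGraph.image (by fun_prop)).isBounded
  · refine LipschitzOnWith.of_dist_le_mul ?_
    rintro _ ⟨z, hz, rfl⟩ _ ⟨w, hw, rfl⟩
    rw [hinj.leftInvOn_invFunOn hz, hinj.leftInvOn_invFunOn hw]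
    exact hd z hz w hw
  · exact hinj.leftInvOn_invFunOn.image_image

/-! ### Finite unions of compact totally disconnected sets. -/

/-- Disjoint closed sets can be separated inside a compact totally disconnected set. -/
lemma IsTotallyDisconnected.exists_closed_partition {X : Type*} [TopologicalSpace X] [T2Space X]
    {B P Q : Set X} (hBc : IsCompact B) (hB : IsTotallyDisconnected B) (hP : IsClosed P)
    (hQ : IsClosed Q) (hPQ : Disjoint P Q) :
    ∃ B₁ B₂ : Set X, IsClosed B₁ ∧ IsClosed B₂ ∧ Disjoint B₁ B₂ ∧ B₁ ∪ B₂ = B ∧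
      Disjoint P B₂ ∧ Disjoint Q B₁ := by
  have : CompactSpace B := isCompact_iff_compactSpace.1 hBc
  have : TotallyDisconnectedSpace B := totallyDisconnectedSpace_subtype_iff.2 hB
  obtain ⟨D, hD, hPD, hDQ⟩ := exists_clopen_of_closed_subset_open
    (Z := ((↑) : B → X) ⁻¹' P) (U := ((↑) : B → X) ⁻¹' Qᶜ)
    (hP.preimage continuous_subtype_val) (hQ.isOpen_compl.preimage continuous_subtype_val)
    (preimage_mono hPQ.subset_compl_right)
  have hemb := hBc.isClosed.isClosedEmbedding_subtypeVal
  refine ⟨(↑) '' D, (↑) '' Dᶜ, hemb.isClosedMap _ hD.isClosed, hemb.isClosedMap _ hD.compl.isClosed,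
    (disjoint_image_iff Subtype.val_injective).2 disjoint_compl_right, ?_, ?_, ?_⟩
  · rw [← image_union, union_compl_self, image_univ, Subtype.range_coe]
  · rw [Set.disjoint_left]
    rintro _ hx ⟨x, hxD, rfl⟩
    exact hxD (hPD hx)
  · rw [Set.disjoint_left]
    rintro _ hx ⟨x, hxD, rfl⟩
    exact hDQ hxD hx

/-- To separate x from y, split A first, then split B compatibly with that splitting. The singletons
are added because x or y may lie outside A. -/
lemma IsTotallyDisconnected.union_of_isCompact {X : Type*} [TopologicalSpace X] [T2Space X]
    {A B : Set X} (hAc : IsCompact A) (hBc : IsCompact B) (hA : IsTotallyDisconnected A)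
    (hB : IsTotallyDisconnected B) : IsTotallyDisconnected (A ∪ B) := by
  intro S hS hSc x hx y hy
  by_contra hxy
  obtain ⟨A₁, A₂, hA₁, hA₂, hA₁₂, hAe, hxA, hyA⟩ := hA.exists_closed_partition hAc
    (isClosed_singleton (x := x)) (isClosed_singleton (x := y)) (disjoint_singleton.2 hxy)
  have hPQ : Disjoint (A₁ ∪ {x}) (A₂ ∪ {y}) := by
    rw [disjoint_union_left, disjoint_union_right, disjoint_union_right]
    exact ⟨⟨hA₁₂, hyA.symm⟩, hxA, disjoint_singleton.2 hxy⟩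
  obtain ⟨B₁, B₂, hB₁, hB₂, hB₁₂, hBe, hPB, hQB⟩ := hB.exists_closed_partition hBc
    (hA₁.union isClosed_singleton) (hA₂.union isClosed_singleton) hPQ
  have hUV : Disjoint ((A₁ ∪ {x}) ∪ B₁) ((A₂ ∪ {y}) ∪ B₂) := by
    rw [disjoint_union_left, disjoint_union_right, disjoint_union_right (s := B₁)]
    exact ⟨⟨hPQ, hPB⟩, hQB.symm, hB₁₂⟩
  have hcov : S ⊆ ((A₁ ∪ {x}) ∪ B₁) ∪ ((A₂ ∪ {y}) ∪ B₂) := by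
    refine hS.trans ?_
    rw [← hAe, ← hBe]
    intro z hz
    simp only [mem_union] at hz ⊢
    tauto
  have hxU : x ∈ (A₁ ∪ {x}) ∪ B₁ := by simp
  have hyV : y ∈ (A₂ ∪ {y}) ∪ B₂ := by simp
  rcases isPreconnected_iff_subset_of_disjoint_closed.1 hSc _ _
    ((hA₁.union isClosed_singleton).union hB₁) ((hA₂.union isClosed_singleton).union hB₂) hcov
    (by rw [hUV.inter_eq, inter_empty]) with h | h
  · exact Set.disjoint_left.1 hUV (h hy) hyV
  · exact Set.disjoint_left.1 hUV hxU (h hx)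

lemma IsTotallyDisconnected.biUnion_of_isCompact {X ι : Type*} [TopologicalSpace X] [T2Space X]
    {s : Set ι} (hs : s.Finite) {F : ι → Set X} (hc : ∀ i ∈ s, IsCompact (F i))
    (h : ∀ i ∈ s, IsTotallyDisconnected (F i)) : IsTotallyDisconnected (⋃ i ∈ s, F i) := by
  induction s, hs using Set.Finite.induction_on with
  | empty => simpa using isTotallyDisconnected_empty
  | @insert a s _ hs ih =>
    rw [biUnion_insert]
    simp only [mem_insert_iff, forall_eq_or_imp] at hc h
    exact IsTotallyDisconnected.union_of_isCompact hc.1 (hs.isCompact_biUnion hc.2) h.1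
      (ih hc.2 h.2)

/-! ### Affine copies of the attractor in ℝ^d. -/

section SelfAffine

variable {d : ℕ}

local notation "E" => EuclideanSpace ℝ (Fin d)

/-- An attractor of affine maps that contract a common gauge comparable to the norm is a
self-affine set: a high iterate of the system contracts the norm. -/
lemma isSelfAffineSet_of_gauge {ι : Type} [Finite ι] (T : ι → (E ≃L[ℝ] E)) (t : ι → E)
    {K : Set E} (hne : K.Nonempty) (hK : IsCompact K)
    (hKe : K = ⋃ i, (fun x => T i x + t i) '' K) (N : E → ℝ) (c r : ℝ) (hc : 0 ≤ c) (hr₀ : 0 ≤ r)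
    (hr : r < 1) (hN : ∀ v, ‖v‖ ≤ N v) (hNc : ∀ v, N v ≤ c * ‖v‖)
    (hT : ∀ i v, N (T i v) ≤ r * N v) : IsSelfAffineSet K := by
  have key : ∀ n : ℕ, ∃ (κ : Type) (_ : Finite κ) (S : κ → (E ≃L[ℝ] E)) (s : κ → E),
      (∀ k v, N (S k v) ≤ r ^ n * N v) ∧ K = ⋃ k, (fun x => S k x + s k) '' K := by
    intro n
    induction n with
    | zero =>
      refine ⟨Unit, inferInstance, fun _ => .refl ℝ E, fun _ => 0, ?_, ?_⟩
      · simp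
      · simp [iUnion_const]
    | succ n ih =>
      obtain ⟨κ, _, S, s, hS, hKs⟩ := ih
      refine ⟨ι × κ, inferInstance, fun p => (S p.2).trans (T p.1),
        fun p => T p.1 (s p.2) + t p.1, ?_, ?_⟩
      · rintro ⟨i, k⟩ v
        calc N (T i (S k v)) ≤ r * N (S k v) := hT i _
          _ ≤ r * (r ^ n * N v) := mul_le_mul_of_nonneg_left (hS k v) hr₀
          _ = r ^ (n + 1) * N v := by ring
      · rw [iUnion_prod']
        conv_lhs => rw [hKe]
        refine iUnion_congr fun i => ?_
        conv_lhs => rw [hKs]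
        rw [image_iUnion]
        refine iUnion_congr fun k => ?_
        rw [image_image]
        refine image_congr fun x _ => ?_
        simp [add_assoc]
  have hlim : Filter.Tendsto (fun n : ℕ => r ^ n * c) Filter.atTop (nhds (0 * c)) :=
    (tendsto_pow_atTop_nhds_zero_of_lt_one hr₀ hr).mul_const c
  rw [zero_mul] at hlim
  obtain ⟨n, hn⟩ := (hlim.eventually_lt_const one_pos).exists
  obtain ⟨κ, _, S, s, hS, hKs⟩ := key n
  obtain ⟨m, ⟨e⟩⟩ := Finite.exists_equiv_fin κ
  refine ⟨m, fun j => S (e.symm j), fun j => s (e.symm j), fun j => ?_, hne, hK, ?_⟩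
  · refine lt_of_le_of_lt (ContinuousLinearMap.opNorm_le_bound _ (by positivity) fun v => ?_) hn
    calc ‖S (e.symm j) v‖ ≤ N (S (e.symm j) v) := hN _
      _ ≤ r ^ n * N v := hS _ _
      _ ≤ r ^ n * (c * ‖v‖) := mul_le_mul_of_nonneg_left (hNc v) (by positivity)
      _ = r ^ n * c * ‖v‖ := by ring
  · rw [e.symm.surjective.iUnion_comp (fun k => (fun x => S k x + s k) '' K)]
    exact hKs

/-- The affine copy of `jumpGraph` that runs from `u` to `v` inside the triangle `u v p`. -/
def jumpArc (u v p : E) : Set E := (fun z : ℝ × ℝ => u + z.1 • (v - u) + z.2 • (p - u)) '' jumpGraph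

/-- The linear map `v ↦ v / 4 + ξ v • w`, invertible if `ξ w = 1 / 4`. -/
lemma exists_shear (ξ : E →L[ℝ] ℝ) (w : E) (hw : ξ w = 1 / 4) :
    ∃ T : E ≃L[ℝ] E, ∀ v, T v = (1 / 4 : ℝ) • v + ξ v • w := by
  set f : E →ₗ[ℝ] E := (1 / 4 : ℝ) • LinearMap.id + (ξ : E →ₗ[ℝ] ℝ).smulRight w with hf
  have hfv : ∀ v, f v = (1 / 4 : ℝ) • v + ξ v • w := fun v => by simp [hf]
  have hinj : Function.Injective f := by
    rw [← LinearMap.ker_eq_bot, LinearMap.ker_eq_bot']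
    intro v hv
    rw [hfv] at hv
    have h1 : ξ v = 0 := by
      have := congrArg ξ hv
      simp only [map_add, map_smul, hw, smul_eq_mul, map_zero] at this
      linarith
    rw [h1, zero_smul, add_zero] at hv
    exact (smul_eq_zero.1 hv).resolve_left (by norm_num)
  exact ⟨(LinearEquiv.ofInjectiveEndo f hinj).toContinuousLinearEquiv, hfv⟩

lemma exists_dual_pair {a b : E} (h : LinearIndependent ℝ ![a, b]) :
    ∃ ξ η : E →L[ℝ] ℝ, ξ a = 1 ∧ ξ b = 0 ∧ η a = 0 ∧ η b = 1 := by
  obtain ⟨g, hg⟩ := (Fintype.linearCombination ℝ ![a, b]).exists_leftInverse_of_injective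
    (LinearMap.ker_eq_bot.2 h.fintypeLinearCombination_injective)
  have ha : g a = Pi.single 0 1 := by
    simpa using LinearMap.congr_fun hg (Pi.single 0 1)
  have hb : g b = Pi.single 1 1 := by
    simpa using LinearMap.congr_fun hg (Pi.single 1 1)
  refine ⟨((LinearMap.proj 0).comp g).toContinuousLinearMap,
    ((LinearMap.proj 1).comp g).toContinuousLinearMap, ?_, ?_, ?_, ?_⟩ <;> simp [ha, hb]

lemma isCompact_jumpArc (u v p : E) : IsCompact (jumpArc u v p) :=
  isCompact_jumpGraph.image (by fun_prop)

lemma isSelfAffineSet_jumpArc {u v p : E} (h : LinearIndependent ℝ ![v - u, p - u]) :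
    IsSelfAffineSet (jumpArc u v p) := by
  obtain ⟨ξ, -, ha, hb, -, -⟩ := exists_dual_pair h
  have hcomp := isCompact_jumpArc u v p
  unfold jumpArc at hcomp ⊢
  set a := v - u
  set b := p - u
  set g : ℝ × ℝ → E := fun z => u + z.1 • a + z.2 • b with hg
  -- The vectors w are chosen so that `T₀` and `T₁` act on the span of a and b as the linear parts
  -- of the branches, while both stay invertible on the whole space.
  obtain ⟨T₀, hT₀⟩ := exists_shear ξ ((1 / 4 : ℝ) • a + (1 / 2 : ℝ) • b) (by simp [ha, hb])
  obtain ⟨T₁, hT₁⟩ := exists_shear ξ ((1 / 4 : ℝ) • a) (by simp [ha])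
  set Z : ℝ := ‖(1 / 4 : ℝ) • a + (1 / 2 : ℝ) • b‖ + ‖(1 / 4 : ℝ) • a‖ with hZ
  have hZ0 : 0 ≤ Z := by positivity
  -- The operator norms of `T₀` and `T₁` may exceed 1. As ξ is halved by T, the weight 4Z yields Z +
  -- 2Z = (3/4)·4Z as the coefficient of |ξ x|.
  have gauge : ∀ (T : E ≃L[ℝ] E) (w : E), ξ w = 1 / 4 → ‖w‖ ≤ Z →
      (∀ x, T x = (1 / 4 : ℝ) • x + ξ x • w) → ∀ x,
      ‖T x‖ + 4 * Z * |ξ (T x)| ≤ 3 / 4 * (‖x‖ + 4 * Z * |ξ x|) := by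
    intro T w hw hwZ hT x
    have h1 : ξ (T x) = ξ x / 2 := by
      rw [hT]; simp only [map_add, map_smul, hw, smul_eq_mul]; ring
    have h2 : ‖T x‖ ≤ 1 / 4 * ‖x‖ + |ξ x| * Z := by
      rw [hT]
      refine (norm_add_le _ _).trans ?_
      rw [norm_smul, norm_smul, Real.norm_eq_abs (ξ x)]
      have := mul_le_mul_of_nonneg_left hwZ (abs_nonneg (ξ x))
      norm_num
      linarith
    rw [h1, abs_div, abs_two]
    have := norm_nonneg x
    linarith
  have hl : ∀ z, T₀ (g z) + (u - T₀ u) = g (leftBranch z) := by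
    intro z
    simp only [hg, map_add, map_smul, hT₀, ha, hb, leftBranch]
    module
  have hr : ∀ z, T₁ (g z) + (u - T₁ u + (1 / 2 : ℝ) • a) = g (rightBranch z) := by
    intro z
    simp only [hg, map_add, map_smul, hT₁, ha, hb, rightBranch]
    module
  refine isSelfAffineSet_of_gauge (fun i : Bool => bif i then T₀ else T₁)
    (fun i => bif i then u - T₀ u else u - T₁ u + (1 / 2 : ℝ) • a)
    (Set.Nonempty.image g ⟨0, zero_mem_jumpGraph⟩) hcomp ?_ (fun x => ‖x‖ + 4 * Z * |ξ x|)
    (1 + 4 * Z * ‖ξ‖) (3 / 4) (by positivity) (by norm_num) (by norm_num) ?_ ?_ ?_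
  · rw [show ∀ F : Bool → Set E, ⋃ i, F i = F true ∪ F false from fun _ => iSup_bool_eq]
    simp only [cond_true, cond_false, image_image, hl, hr]
    conv_lhs => rw [jumpGraph_eq, branchStep, image_union, image_image, image_image]
  · intro x
    have : 0 ≤ 4 * Z * |ξ x| := by positivity
    linarith
  · intro x
    have h1 : |ξ x| ≤ ‖ξ‖ * ‖x‖ := ξ.le_opNorm x
    have h2 := mul_le_mul_of_nonneg_left h1 (by positivity : 0 ≤ 4 * Z)
    linarith
  · rintro (_ | _) x
    · exact gauge T₁ _ (by simp [ha])
        (by rw [hZ]; linarith [norm_nonneg ((1 / 4 : ℝ) • a + (1 / 2 : ℝ) • b)]) hT₁ x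
    · exact gauge T₀ _ (by simp [ha, hb])
        (by rw [hZ]; linarith [norm_nonneg ((1 / 4 : ℝ) • a)]) hT₀ x

/-- The dual pair recovers the planar coordinates continuously, so preconnected subsets of the arc
map to preconnected subsets of `jumpGraph`. -/
lemma isTotallyDisconnected_jumpArc {u v p : E} (h : LinearIndependent ℝ ![v - u, p - u]) :
    IsTotallyDisconnected (jumpArc u v p) := by
  obtain ⟨ξ, η, h1, h2, h3, h4⟩ := exists_dual_pair h
  intro S hS hc
  have hinv : ∀ z : ℝ × ℝ, (fun x => (ξ (x - u), η (x - u)))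
      (u + z.1 • (v - u) + z.2 • (p - u)) = z := by
    intro z
    simp only [add_assoc, add_sub_cancel_left]
    simp [-map_sub, h1, h2, h3, h4]
  have hsub : (fun x => (ξ (x - u), η (x - u))) '' S ⊆ jumpGraph := by
    rintro _ ⟨x, hx, rfl⟩
    obtain ⟨z, hz, rfl⟩ := hS hx
    rwa [hinv]
  have hss := isTotallyDisconnected_jumpGraph _ hsub
    (hc.image _ (Continuous.continuousOn (by fun_prop)))
  intro x hx y hy
  obtain ⟨z, hz, rfl⟩ := hS hx
  obtain ⟨w, hw, rfl⟩ := hS hy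
  have := hss (mem_image_of_mem _ hx) (mem_image_of_mem _ hy)
  rw [show z = w from (hinv z).symm.trans (this.trans (hinv w))]

lemma jumpArc_subset_convexHull (u v p : E) : jumpArc u v p ⊆ convexHull ℝ {u, v, p} := by
  rintro _ ⟨z, hz, rfl⟩
  obtain ⟨h1, h2, h3⟩ := jumpGraph_subset_baseTriangle hz
  have hc := convex_convexHull ℝ ({u, v, p} : Set E)
  have hm := subset_convexHull ℝ ({u, v, p} : Set E)
  have := hc.sum_mem (t := Finset.univ) (w := ![1 - z.1 - z.2, z.1, z.2]) (z := ![u, v, p])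
    (by intro i _; fin_cases i <;> simp <;> linarith)
    (by simp [Fin.sum_univ_three]; ring)
    (by intro i _; fin_cases i <;> exact hm (by simp))
  convert this using 1
  simp only [Fin.sum_univ_three, Matrix.cons_val_zero, Matrix.cons_val_one, Matrix.cons_val]
  module

lemma left_mem_jumpArc (u v p : E) : u ∈ jumpArc u v p := ⟨0, zero_mem_jumpGraph, by simp⟩

/-- A linear functional that is minimal at `u` and maximal at `v` takes all intermediate values on
the arc from `u` to `v`. -/
lemma exists_mem_jumpArc {u v p : E} (f : E →ₗ[ℝ] ℝ) (hup : f u ≤ f p) {c : ℝ}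
    (huv : f u < f v) (hc : c ∈ Icc (f u) (f v)) : ∃ x ∈ jumpArc u v p, f x = c := by
  have hpos : 0 < f v - f u := by linarith
  -- Normalizing f to 0 at u and 1 at v turns it into x + s·y, where s is the normalized value at p.
  obtain ⟨z, hz, h⟩ := exists_mem_jumpGraph (s := (f p - f u) / (f v - f u))
    (c := (c - f u) / (f v - f u)) (div_nonneg (by linarith) hpos.le)
    ⟨div_nonneg (by linarith [hc.1]) hpos.le, by rw [div_le_one hpos]; linarith [hc.2]⟩
  refine ⟨_, ⟨z, hz, rfl⟩, ?_⟩
  simp only [map_add, map_smul, map_sub, smul_eq_mul]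
  field_simp at h
  linarith

lemma exists_lipschitz_param_jumpArc (u v p : E) : ∃ (A : Set ℝ) (g : ℝ → E) (L : ℝ≥0),
    Bornology.IsBounded A ∧ LipschitzOnWith L g A ∧ g '' A = jumpArc u v p := by
  obtain ⟨A, g, hA, hg, hgA⟩ := exists_lipschitz_param_jumpGraph
  have hG : LipschitzWith (‖v - u‖₊ + ‖p - u‖₊)
      (fun z : ℝ × ℝ => u + z.1 • (v - u) + z.2 • (p - u)) := by
    refine LipschitzWith.of_dist_le_mul fun z w => ?_
    rw [dist_eq_norm, Prod.dist_eq, Real.dist_eq, Real.dist_eq]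
    have h1 : u + z.1 • (v - u) + z.2 • (p - u) - (u + w.1 • (v - u) + w.2 • (p - u))
      = (z.1 - w.1) • (v - u) + (z.2 - w.2) • (p - u) := by module
    rw [h1]
    refine (norm_add_le _ _).trans ?_
    rw [norm_smul, norm_smul, Real.norm_eq_abs, Real.norm_eq_abs, NNReal.coe_add, coe_nnnorm,
      coe_nnnorm, add_mul, mul_comm |z.1 - w.1|, mul_comm |z.2 - w.2|]
    gcongr
    · exact le_max_left _ _
    · exact le_max_right _ _
  refine ⟨A, _, _, hA, hG.comp_lipschitzOnWith hg, ?_⟩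
  rw [image_comp, hgA, jumpArc]

lemma hausdorffMeasure_one_jumpArc_lt_top (u v p : E) :
    (Measure.hausdorffMeasure 1 : Measure E) (jumpArc u v p) < ∞ := by
  obtain ⟨A, g, L, hA, hg, hgA⟩ := exists_lipschitz_param_jumpArc u v p
  rw [← hgA]
  refine (hg.hausdorffMeasure_image_le zero_le_one).trans_lt ?_
  rw [hausdorffMeasure_real]
  exact ENNReal.mul_lt_top (by simp) hA.measure_lt_top

/-- The functional ξ is constant on the side from u to p, and it maps the arc onto a set containing
an interval of length 1. -/
lemma hausdorffMeasure_one_jumpArc_pos {u v p : E} (h : LinearIndependent ℝ ![v - u, p - u]) :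
    0 < (Measure.hausdorffMeasure 1 : Measure E) (jumpArc u v p) := by
  obtain ⟨ξ, -, ha, hb, -, -⟩ := exists_dual_pair h
  rw [map_sub] at ha hb
  have hsub : Icc (ξ u) (ξ v) ⊆ ξ '' jumpArc u v p := fun c hc =>
    exists_mem_jumpArc (ξ : E →ₗ[ℝ] ℝ) (sub_eq_zero.1 hb).ge (by simp; linarith) hc
  have h1 := (measure_mono (μ := (Measure.hausdorffMeasure 1 : Measure ℝ)) hsub).trans
    (ξ.lipschitz.hausdorffMeasure_image_le zero_le_one _)
  rw [hausdorffMeasure_real, Real.volume_Icc, ha, ENNReal.ofReal_one] at h1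
  by_contra h0
  rw [not_lt, nonpos_iff_eq_zero] at h0
  rw [h0, mul_zero] at h1
  exact absurd h1 (by simp)

/-! ### The union of arcs over the triangles of a polytope. -/

/-- The triples of elements of `V` that span a nondegenerate triangle. -/
def triangleTriples (V : Set E) : Set (E × E × E) :=
  {τ | τ.1 ∈ V ∧ τ.2.1 ∈ V ∧ τ.2.2 ∈ V ∧ LinearIndependent ℝ ![τ.2.1 - τ.1, τ.2.2 - τ.1]}

lemma finite_triangleTriples {V : Set E} (hV : V.Finite) : (triangleTriples V).Finite :=
  (hV.prod (hV.prod hV)).subset fun _ h => ⟨h.1, h.2.1, h.2.2.1⟩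

/-- The union of the arcs over all nondegenerate triangles with vertices in `V`. -/
def jumpFrame (V : Set E) : Set E := ⋃ τ ∈ triangleTriples V, jumpArc τ.1 τ.2.1 τ.2.2

lemma exists_triangleTriple {V : Set E} (hV : ¬ Collinear ℝ V) {u v : E} (hu : u ∈ V) (hv : v ∈ V)
    (huv : u ≠ v) : ∃ p, (u, v, p) ∈ triangleTriples V := by
  by_contra! hcon
  refine hV ((collinear_iff_of_mem hu).2 ⟨v - u, fun p hp => ?_⟩)
  have hli : ¬ LinearIndependent ℝ ![v - u, p - u] := fun h => hcon p ⟨hu, hv, hp, h⟩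
  rw [LinearIndependent.pair_iff' (sub_ne_zero.2 huv.symm)] at hli
  push Not at hli
  obtain ⟨r, hr⟩ := hli
  exact ⟨r, by rw [hr]; simp⟩

lemma exists_triangleTriple_left {V : Set E} (hV : ¬ Collinear ℝ V) {u : E} (hu : u ∈ V) :
    ∃ v p, (u, v, p) ∈ triangleTriples V := by
  have : ∃ v ∈ V, u ≠ v := by
    by_contra! hcon
    exact hV ((collinear_singleton ℝ u).subset fun v hv => (hcon v hv).symm)
  obtain ⟨v, hv, huv⟩ := this
  exact ⟨v, exists_triangleTriple hV hu hv huv⟩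

lemma isCompact_jumpFrame {V : Set E} (hV : V.Finite) : IsCompact (jumpFrame V) :=
  (finite_triangleTriples hV).isCompact_biUnion fun _ _ => isCompact_jumpArc _ _ _

lemma isTotallyDisconnected_jumpFrame {V : Set E} (hV : V.Finite) :
    IsTotallyDisconnected (jumpFrame V) :=
  IsTotallyDisconnected.biUnion_of_isCompact (finite_triangleTriples hV)
    (fun _ _ => isCompact_jumpArc _ _ _) fun _ h => isTotallyDisconnected_jumpArc h.2.2.2

lemma isFiniteUnionOfSelfAffineSets_jumpFrame {V : Set E} (hV : V.Finite) :
    IsFiniteUnionOfSelfAffineSets (jumpFrame V) := by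
  have := (finite_triangleTriples hV).to_subtype
  obtain ⟨n, ⟨e⟩⟩ := Finite.exists_equiv_fin (triangleTriples V)
  refine ⟨n, fun j => jumpArc (e.symm j).1.1 (e.symm j).1.2.1 (e.symm j).1.2.2,
    fun j => isSelfAffineSet_jumpArc (e.symm j).2.2.2.2, ?_⟩
  rw [e.symm.surjective.iUnion_comp
    (fun τ : triangleTriples V => jumpArc τ.1.1 τ.1.2.1 τ.1.2.2), jumpFrame, biUnion_eq_iUnion]

lemma isRectifiableOneSet_jumpFrame {V : Set E} (hV : V.Finite) (hcol : ¬ Collinear ℝ V) :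
    IsRectifiableOneSet (jumpFrame V) := by
  have hfin := finite_triangleTriples hV
  obtain ⟨u, hu⟩ : V.Nonempty := nonempty_iff_ne_empty.2 fun h => hcol (h ▸ collinear_empty ℝ E)
  obtain ⟨v, p, hτ⟩ := exists_triangleTriple_left hcol hu
  refine ⟨⟨?_, ?_⟩, ?_⟩
  · exact (hausdorffMeasure_one_jumpArc_pos hτ.2.2.2).trans_le
      (measure_mono (subset_biUnion_of_mem (u := fun τ : E × E × E => jumpArc τ.1 τ.2.1 τ.2.2) hτ))
  · exact measure_biUnion_lt_top hfin fun _ _ => hausdorffMeasure_one_jumpArc_lt_top _ _ _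
  · have : Nonempty (triangleTriples V) := ⟨⟨_, hτ⟩⟩
    have := hfin.countable.to_subtype
    obtain ⟨e, he⟩ := exists_surjective_nat (triangleTriples V)
    choose A g L _ hg hgA using fun n =>
      exists_lipschitz_param_jumpArc (e n).1.1 (e n).1.2.1 (e n).1.2.2
    refine ⟨A, g, L, hg, ?_⟩
    have : jumpFrame V = ⋃ i, g i '' A i := by
      simp only [hgA]
      rw [he.iUnion_comp (fun τ : triangleTriples V => jumpArc τ.1.1 τ.1.2.1 τ.1.2.2), jumpFrame,
        biUnion_eq_iUnion]
    rw [← this, sdiff_self, measure_empty]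

lemma convexHull_jumpFrame {V : Set E} (hcol : ¬ Collinear ℝ V) :
    convexHull ℝ (jumpFrame V) = convexHull ℝ V := by
  apply Subset.antisymm
  · refine convexHull_min (iUnion₂_subset fun τ hτ => ?_) (convex_convexHull ℝ V)
    refine (jumpArc_subset_convexHull _ _ _).trans (convexHull_mono ?_)
    rintro x (rfl | rfl | rfl)
    exacts [hτ.1, hτ.2.1, hτ.2.2.1]
  · refine convexHull_mono fun u hu => ?_
    obtain ⟨v, p, hτ⟩ := exists_triangleTriple_left hcol hu
    exact mem_biUnion hτ (left_mem_jumpArc u v p)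

/-- Every linear functional takes the same values on `jumpFrame V` and on the convex hull of `V`. -/
lemma exists_mem_jumpFrame {V : Set E} (hV : V.Finite) (hcol : ¬ Collinear ℝ V) (f : E →ₗ[ℝ] ℝ)
    {x : E} (hx : x ∈ convexHull ℝ V) : ∃ y ∈ jumpFrame V, f y = f x := by
  have hne : V.Nonempty := convexHull_nonempty_iff.1 ⟨x, hx⟩
  obtain ⟨u, hu, hmin⟩ := hV.exists_minimalFor f V hne
  obtain ⟨v, hv, hmax⟩ := hV.exists_maximalFor f V hne
  have hmin : ∀ p ∈ V, f u ≤ f p := fun p hp => (le_total (f u) (f p)).elim id (hmin hp)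
  have hmax : ∀ p ∈ V, f p ≤ f v := fun p hp => (le_total (f p) (f v)).elim id (hmax hp)
  have h1 : f u ≤ f x := convexHull_min (t := {y | f u ≤ f y}) hmin
    (convex_halfSpace_ge f.isLinear _) hx
  have h2 : f x ≤ f v := convexHull_min (t := {y | f y ≤ f v}) hmax
    (convex_halfSpace_le f.isLinear _) hx
  -- If f is constant on V, the starting point u of any arc suffices.
  rcases eq_or_lt_of_le (h1.trans h2) with h | h
  · obtain ⟨v', p, hτ⟩ := exists_triangleTriple_left hcol hu
    exact ⟨u, mem_biUnion hτ (left_mem_jumpArc u v' p), by linarith⟩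
  · obtain ⟨p, hτ⟩ := exists_triangleTriple hcol hu hv (fun h' => by simp [h'] at h)
    obtain ⟨y, hy, hyx⟩ := exists_mem_jumpArc (p := p) f (hmin p hτ.2.2.1) h ⟨h1, h2⟩
    exact ⟨y, mem_biUnion hτ hy, hyx⟩

/-- Projection onto the line spanned by w depends only on the inner product with w, so hitting all
values of linear functionals is enough. -/
lemma fractalDecomposable_jumpFrame {V : Set E} (hV : V.Finite) (hcol : ¬ Collinear ℝ V) :
    FractalDecomposable 1 (convexHull ℝ V) (jumpFrame V) := by
  refine ⟨convexHull_jumpFrame hcol, fun W hW => Subset.antisymm (image_mono ?_) ?_⟩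
  · rw [← convexHull_jumpFrame hcol]
    exact subset_convexHull ℝ _
  · rintro _ ⟨x, hx, rfl⟩
    obtain ⟨⟨w, hw⟩, -, hspan⟩ := finrank_eq_one_iff'.1 hW
    have hWw : W = ℝ ∙ w := by
      apply le_antisymm
      · intro y hy
        obtain ⟨c, hc⟩ := hspan ⟨y, hy⟩
        exact Submodule.mem_span_singleton.2 ⟨c, congrArg Subtype.val hc⟩
      · rwa [Submodule.span_singleton_le_iff_mem]
    obtain ⟨y, hy, hyx⟩ := exists_mem_jumpFrame hV hcol (innerSL ℝ w : E →ₗ[ℝ] ℝ) hx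
    refine ⟨y, hy, ?_⟩
    simp only [ContinuousLinearMap.coe_coe, innerSL_apply_apply] at hyx
    subst hWw
    rw [Submodule.starProjection_singleton, Submodule.starProjection_singleton, hyx]

lemma IsRectifiableOneSet.dimH_eq_one {K : Set E} (hK : IsRectifiableOneSet K) : dimH K = 1 := by
  apply le_antisymm
  · exact_mod_cast dimH_le_of_hausdorffMeasure_ne_top (d := 1) (by simpa using hK.1.2.ne)
  · exact_mod_cast le_dimH_of_hausdorffMeasure_ne_zero (d := 1) (by simpa using hK.1.1.ne')

end SelfAffine

theorem mainTheorem1 (d : ℕ) (C : Set (EuclideanSpace ℝ (Fin d))) (hC : IsConvexPolytope C)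
    (hdim : ¬ Collinear ℝ C) :
    (∀ ε : ℝ, 0 < ε → ∃ K : Set (EuclideanSpace ℝ (Fin d)),
      IsTotallyDisconnected K ∧ IsCompact K ∧ IsFiniteUnionOfSelfAffineSets K ∧
        1 ≤ dimH K ∧ dimH K ≤ 1 + ENNReal.ofReal ε ∧ FractalDecomposable 1 C K) ∧
    (∃ K : Set (EuclideanSpace ℝ (Fin d)),
      IsTotallyDisconnected K ∧ IsCompact K ∧ IsRectifiableOneSet K ∧
        FractalDecomposable 1 C K) := by
  obtain ⟨V, rfl⟩ := hC
  have hV := V.finite_toSet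
  have hcol : ¬ Collinear ℝ (V : Set (EuclideanSpace ℝ (Fin d))) := by
    intro h
    apply hdim
    -- Collinearity depends only on the affine span, which passing to the convex hull does not
    -- change.
    rw [Collinear, ← direction_affineSpan, affineSpan_convexHull, direction_affineSpan]
    exact h
  have hrect := isRectifiableOneSet_jumpFrame hV hcol
  refine ⟨fun ε _ => ⟨jumpFrame V, isTotallyDisconnected_jumpFrame hV, isCompact_jumpFrame hV,
    isFiniteUnionOfSelfAffineSets_jumpFrame hV, hrect.dimH_eq_one.ge, ?_,
    fractalDecomposable_jumpFrame hV hcol⟩, jumpFrame V, isTotallyDisconnected_jumpFrame hV,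
    isCompact_jumpFrame hV, hrect, fractalDecomposable_jumpFrame hV hcol⟩
  rw [hrect.dimH_eq_one]
  exact le_self_add
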